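/- Let $O(1)=\{\pm1\}$, let $\mathbb P=BO(1)$ be the corresponding one-object groupoid, and let $\mathcal Z$ be the 2-category of finite groupoids over $\mathbb P$ (finitely many isomorphism classes, finite hom sets): an object is a finite groupoid $X$ with a functor $X\to\mathbb P$, that is, a multiplicative assignment of a parity $\operatorname{par}(a)\in\{\pm1\}$ to each arrow $a$; a morphism is a functor together with a natural transformation over $\mathbb P$, with components in $\{\pm1\}$. A point $x\in X$ is orientable if every automorphism of $x$ has parity $+1$; $X^\circ\subset X$ is the full subgroupoid of orientable points. Write $\|x!\|$ for the order of $x!=\operatorname{Aut}(x)$. For a span $S\xleftarrow{s}M\xrightarrow{t}T$ in $\mathcal Z$, whose legs have 2-cells with components $\epsilon'_m,\epsilon_m$, put $\rho_m=(\epsilon'_m)^{-1}\epsilon_m$. For points $i\in S$, $j\in T$, the two-sided homotopy fibre ${}_iM_j$ has as objects the triples $(m,\ a\colon i\to s(m),\ b\colon t(m)\to j)$; such an object has the sign $\operatorname{par}(a)\,\rho_m\operatorname{par}(b)$, which is invariant under isomorphism. Let $\|{}_iM_j\|\in\mathbb Q$ be the homotopy cardinality $\sum_c 1/|\operatorname{Aut}(c)|$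 of the part of sign $+1$ minus that of the part of sign $-1$. Given a base point in each orientable component of $S$ and of $T$, the cardinality $\|M\|$ is the $\pi_0(S^\circ)\times\pi_0(T^\circ)$ rational matrix with entries $\|{}_iM_j\|/\|j!\|$ at the base points $i$, $j$. The exterior power $\Lambda^kX$ is the weak quotient $X^k/\Sigma_k$: its objects are $k$-tuples of objects of $X$, an arrow $(y_1,\dots,y_k)\to(x_1,\dots,x_k)$ is a permutation $\sigma$ together with arrows $\gamma_j\colon y_j\to x_{\sigma(j)}$ of $X$, and its parity is $\operatorname{sign}(\sigma)\prod_j\operatorname{par}(\gamma_j)$. Exterior powers of spans are taken componentwise, multiplying the components of the 2-cells. **Theorem.** Let $X$ be an object of $\mathcal Z$ with $n$ orientable components, let $X\leftarrow A\to X$ be an endo-span in $\mathcal Z$, and let $\operatorname{Det}(A)$ be the span $\Lambda^nX\leftarrow\Lambda^nA\to\Lambda^nX$. Then: (1) $\Lambda^nX$ has exactly one orientable component, so that $\|\operatorname{Det}(A)\|$ is a $1\times1$ matrix. (2) $\|\operatorname{Det}(A)\|=\det\|A\|$ as rational numbers, for every choice of base points of $X$ (the same for rows and columns of $\|A\|$)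 and every choice of base point of $\Lambda^nX$ (the same for both sides of $\operatorname{Det}(A)$). (3) Explicitly, if $x_1,\dots,x_n$ are base points, one in each orientable component of $X$, then $\underline x=(x_1,\dots,x_n)$ is an orientable point of $\Lambda^nX$, $\|\underline x!\|=\prod_i\|x_i!\|$, and $$\frac{\|{}_{\underline x}(\Lambda^nA)_{\underline x}\|}{\|\underline x!\|}=\det\left(\frac{\|{}_{x_i}A_{x_j}\|}{\|x_j!\|}\right)_{1\le i,j\le n}.$$ -/

import Mathlib

open CategoryTheory

universe u

namespace ObjLin

/-! ## Finite groupoids and their homotopy cardinality -/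

/-- The set of connected components `π₀ C` of a groupoid: objects modulo isomorphism. -/
abbrev Pi0 (C : Type u) [SmallGroupoid C] : Type u :=
  Quotient (isIsomorphicSetoid C)

/-- The connected component of an object. -/
abbrev comp {C : Type u} [SmallGroupoid C] (x : C) : Pi0 C :=
  Quotient.mk (isIsomorphicSetoid C) x

/-- A groupoid is finite (in the homotopy sense) if it has finitely many connected components and
finite hom sets. -/
class FiniteGroupoid (C : Type u) [SmallGroupoid C] : Prop where
  finite_pi0 : Finite (Pi0 C)
  finite_hom : ∀ x y : C, Finite (x ⟶ y)

attribute [instance] FiniteGroupoid.finite_pi0 FiniteGroupoid.finite_hom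

noncomputable instance (C : Type u) [SmallGroupoid C] [FiniteGroupoid C] : Fintype (Pi0 C) :=
  Fintype.ofFinite _

noncomputable instance (C : Type u) [SmallGroupoid C] : DecidableEq (Pi0 C) :=
  Classical.decEq _

/-- The number `‖x!‖` of automorphisms of an object. -/
noncomputable def autCard {C : Type u} [SmallGroupoid C] (x : C) : ℕ := Nat.card (Aut x)

/-- Homotopy cardinality of a finite groupoid: the sum over the connected components `c` of
`1 / ‖x!‖`, where `x` is any object of `c`. -/
noncomputable def groupoidCard (C : Type u) [SmallGroupoid C] [FiniteGroupoid C] : ℚ :=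
  ∑ c : Pi0 C, 1 / (autCard c.out : ℚ)

instance fullSubgroupoid {C : Type u} [SmallGroupoid C] (P : ObjectProperty C) :
    SmallGroupoid P.FullSubcategory where
  inv f := ObjectProperty.homMk (Groupoid.inv f.hom)
  inv_comp f := by ext; simp
  comp_inv f := by ext; simp

/-- A full subgroupoid of a finite groupoid is finite. -/
instance finite_fullSubgroupoid {C : Type u} [SmallGroupoid C] [FiniteGroupoid C]
    (P : ObjectProperty C) : FiniteGroupoid P.FullSubcategory where
  finite_pi0 := by
    refine Finite.of_injective
      (Quotient.map' (fun x : P.FullSubcategory => x.obj) ?_ : Pi0 P.FullSubcategory → Pi0 C) ?_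
    · rintro x y ⟨e⟩
      exact ⟨P.ι.mapIso e⟩
    · intro a b
      induction a using Quotient.inductionOn
      induction b using Quotient.inductionOn
      intro h
      obtain ⟨e⟩ := Quotient.exact h
      exact Quotient.sound ⟨P.isoMk e⟩
  finite_hom x y := Finite.of_injective (fun f : x ⟶ y => f.hom)
    (fun _ _ h => ObjectProperty.hom_ext P h)

/-! ## Parity structures: the weak slice `𝒵` of finite groupoids over `ℙ = BO(1)` -/

/-- The one-object groupoid `ℙ = BO(1)`, with `O(1) = {+1, -1}`. -/
abbrev Par : Type := SingleObj ℤˣ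

/-- An object of `𝒵`: a finite groupoid with a parity structure. -/
structure ZObj : Type (u + 1) where
  carrier : Type u
  [grpd : SmallGroupoid carrier]
  [fin : FiniteGroupoid carrier]
  str : carrier ⥤ Par

attribute [instance] ZObj.grpd ZObj.fin

instance : CoeSort ZObj.{u} (Type u) := ⟨ZObj.carrier⟩

/-- The parity `±1` of an arrow. -/
def ZObj.par (X : ZObj.{u}) {x y : X} (a : x ⟶ y) : ℤˣ := X.str.map a

@[simp] theorem ZObj.par_id (X : ZObj.{u}) (x : X) : X.par (𝟙 x) = 1 :=
  X.str.map_id x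

@[simp] theorem ZObj.par_comp (X : ZObj.{u}) {x y z : X} (a : x ⟶ y) (b : y ⟶ z) :
    X.par (a ≫ b) = X.par a * X.par b :=
  (X.str.map_comp a b).trans (mul_comm (X.par b) (X.par a))

/-- A morphism of `𝒵`: a functor together with a 2-cell over `ℙ`. -/
structure ZHom (X Y : ZObj.{u}) : Type u where
  functor : X ⥤ Y
  cell : X.str ⟶ functor ⋙ Y.str

/-- The component in `O(1)` of the 2-cell of a morphism of `𝒵`. -/
def ZHom.sgn {X Y : ZObj.{u}} (F : ZHom X Y) (x : X) : ℤˣ := F.cell.app x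

theorem ZHom.naturality {X Y : ZObj.{u}} (F : ZHom X Y) {x y : X} (a : x ⟶ y) :
    X.par a * F.sgn y = F.sgn x * Y.par (F.functor.map a) :=
  (mul_comm (X.par a) (F.sgn y)).trans
    ((F.cell.naturality a).trans (mul_comm (Y.par (F.functor.map a)) (F.sgn x)))

/-- A functor to `ℙ` from a multiplicative assignment of parities to arrows. -/
def mkStr {C : Type u} [SmallGroupoid C] (p : ∀ {x y : C}, (x ⟶ y) → ℤˣ)
    (p_id : ∀ x : C, p (𝟙 x) = 1)
    (p_comp : ∀ {x y z : C} (a : x ⟶ y) (b : y ⟶ z), p (a ≫ b) = p a * p b) : C ⥤ Par where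
  obj _ := SingleObj.star ℤˣ
  map a := p a
  map_id x := p_id x
  map_comp a b := (p_comp a b).trans (mul_comm (p a) (p b))

/-- A morphism of `𝒵` from the components of its 2-cell. -/
def mkHom {X Y : ZObj.{u}} (F : X ⥤ Y) (s : X → ℤˣ)
    (nat : ∀ {x y : X} (a : x ⟶ y), X.par a * s y = s x * Y.par (F.map a)) : ZHom X Y where
  functor := F
  cell :=
    { app := fun x => s x
      naturality := fun x y (a : x ⟶ y) =>
        (mul_comm (s y) (X.par a)).trans ((nat a).trans (mul_comm (s x) (Y.par (F.map a)))) }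

/-! ## Orientable locus -/

/-- A point is orientable if it has no odd automorphisms. -/
def ZObj.Orientable (X : ZObj.{u}) : ObjectProperty X := fun x => ∀ g : x ⟶ x, X.par g = 1

/-- The orientable locus `X°`: the full subgroupoid on the orientable points. -/
abbrev ZObj.Locus (X : ZObj.{u}) : Type u := X.Orientable.FullSubcategory

/-- The number of orientable components of `X`. -/
noncomputable def ZObj.dim (X : ZObj.{u}) : ℕ := Nat.card (Pi0 X.Locus)

/-- A basis: a choice of a base point in each orientable component. -/
structure Basis (X : ZObj.{u}) where
  pt : Pi0 X.Locus → X.Locus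
  comp_pt : ∀ c, comp (pt c) = c

/-! ## Spans and scalars -/

/-- A span `S ← M → T` in `𝒵`. -/
structure PSpan (S T : ZObj.{u}) where
  apex : ZObj.{u}
  left : ZHom apex S
  right : ZHom apex T

/-- The ratio between the two 2-cells of a span, at a point of the apex. -/
def PSpan.ratio {S T : ZObj.{u}} (M : PSpan S T) (m : M.apex) : ℤˣ :=
  (M.left.sgn m)⁻¹ * M.right.sgn m

instance : FiniteGroupoid (Discrete PUnit.{u + 1}) where
  finite_pi0 := Quotient.finite _
  finite_hom _ _ := inferInstance

/-- The unit object `e : 1 → ℙ`. -/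
def unitObj : ZObj.{u} where
  carrier := Discrete PUnit.{u + 1}
  str := (Functor.const _).obj (SingleObj.star ℤˣ)

/-- A scalar: a span from `e` to `e`. -/
abbrev Scalar : Type (u + 1) := PSpan unitObj.{u} unitObj.{u}

/-- The part of a scalar of sign `ε`. -/
abbrev Scalar.part (S : Scalar.{u}) (ε : ℤˣ) : Type u :=
  ObjectProperty.FullSubcategory (C := S.apex) (fun x => S.ratio x = ε)

/-- Cardinality of a scalar: that of its positive part minus that of its negative part. -/
noncomputable def Scalar.card (S : Scalar.{u}) : ℚ :=
  groupoidCard (Scalar.part S 1) - groupoidCard (Scalar.part S (-1))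

/-! ## Two-sided fibres and the cardinality matrix -/

/-- Objects of the two-sided (homotopy) fibre of a span `S ← M → T` over points `i` of `S` and `j`
of `T`, i.e. of the homotopy limit of `1 → S ← M → T ← 1`. -/
structure PSpan.Fib {S T : ZObj.{u}} (M : PSpan S T) (i : S) (j : T) : Type u where
  pt : M.apex
  src : i ⟶ M.left.functor.obj pt
  tgt : M.right.functor.obj pt ⟶ j

namespace PSpan.Fib

variable {S T : ZObj.{u}} {M : PSpan S T} {i : S} {j : T}

/-- Arrows of the two-sided fibre. -/
@[ext]
structure Hom (p q : M.Fib i j) : Type u where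
  hom : p.pt ⟶ q.pt
  src_comp : p.src ≫ M.left.functor.map hom = q.src
  comp_tgt : M.right.functor.map hom ≫ q.tgt = p.tgt

attribute [simp] Hom.src_comp Hom.comp_tgt

instance : SmallCategory (M.Fib i j) where
  Hom p q := Hom p q
  id p := ⟨𝟙 _, by simp, by simp⟩
  comp f g := ⟨f.hom ≫ g.hom, by simp [← Category.assoc], by simp⟩
  id_comp f := Hom.ext (Category.id_comp f.hom)
  comp_id f := Hom.ext (Category.comp_id f.hom)
  assoc f g h := Hom.ext (Category.assoc f.hom g.hom h.hom)

instance : SmallGroupoid (M.Fib i j) where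
  inv f := ⟨Groupoid.inv f.hom,
    by rw [← f.src_comp, Category.assoc, ← Functor.map_comp]; simp,
    by rw [← f.comp_tgt, ← Category.assoc, ← Functor.map_comp]; simp⟩
  inv_comp f := Hom.ext (Groupoid.inv_comp f.hom)
  comp_inv f := Hom.ext (Groupoid.comp_inv f.hom)

/-- The two-sided fibres of a span of finite groupoids are finite. -/
instance : FiniteGroupoid (M.Fib i j) where
  finite_pi0 := by
    let F : (Σ c : Pi0 M.apex, (i ⟶ M.left.functor.obj c.out) × (M.right.functor.obj c.out ⟶ j)) →
        Pi0 (M.Fib i j) := fun x => comp ⟨x.1.out, x.2.1, x.2.2⟩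
    refine Finite.of_surjective F fun a => ?_
    induction a using Quotient.inductionOn with
    | h p =>
      obtain ⟨e⟩ : Nonempty ((comp p.pt).out ≅ p.pt) := Quotient.mk_out (s := isIsomorphicSetoid _) p.pt
      refine ⟨⟨comp p.pt, p.src ≫ M.left.functor.map e.inv, M.right.functor.map e.hom ≫ p.tgt⟩,
        Quotient.sound ⟨(Groupoid.isoEquivHom _ _).symm ⟨e.hom, ?_, rfl⟩⟩⟩
      rw [Category.assoc, ← Functor.map_comp]
      simp
  finite_hom p q := Finite.of_injective (fun f : p ⟶ q => Hom.hom f) (fun _ _ h => Hom.ext h)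

end PSpan.Fib

/-- The two-sided fibre as a scalar. The parity structure on the apex is that of the apex of the
span; the 2-cells are obtained by pasting those of the span with those of the two homotopy pullback
squares, so that the sign of a point `(m, a, b)` is `par a * ratio m * par b`. -/
def PSpan.fibre {S T : ZObj.{u}} (M : PSpan S T) (i : S) (j : T) : Scalar.{u} where
  apex :=
    { carrier := M.Fib i j
      str := mkStr (fun f => M.apex.par (PSpan.Fib.Hom.hom f))
        (fun p => M.apex.par_id p.pt)
        (fun f g => M.apex.par_comp (PSpan.Fib.Hom.hom f) (PSpan.Fib.Hom.hom g)) }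
  left := mkHom ((Functor.const _).obj ⟨⟨⟩⟩) (fun p => M.left.sgn p.pt * (S.par p.src)⁻¹) (by
    intro p q f
    change M.apex.par (PSpan.Fib.Hom.hom f) * _ = _ * 1
    rw [← PSpan.Fib.Hom.src_comp f, S.par_comp, ← mul_assoc, M.left.naturality, mul_one]
    group)
  right := mkHom ((Functor.const _).obj ⟨⟨⟩⟩) (fun p => M.right.sgn p.pt * T.par p.tgt) (by
    intro p q f
    change M.apex.par (PSpan.Fib.Hom.hom f) * _ = _ * 1
    rw [← PSpan.Fib.Hom.comp_tgt f, T.par_comp, ← mul_assoc, M.right.naturality, mul_one,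
      mul_assoc])

theorem PSpan.fibre_ratio {S T : ZObj.{u}} (M : PSpan S T) (i : S) (j : T) (p : M.Fib i j) :
    (M.fibre i j).ratio p = S.par p.src * M.ratio p.pt * T.par p.tgt := by
  change (M.left.sgn p.pt * (S.par p.src)⁻¹)⁻¹ * (M.right.sgn p.pt * T.par p.tgt) =
    S.par p.src * ((M.left.sgn p.pt)⁻¹ * M.right.sgn p.pt) * T.par p.tgt
  group

/-- The cardinality of a span, a rational matrix indexed by the orientable components, with
respect to bases of source and target. Its entries are `‖ᵢMⱼ‖ / ‖j!‖`. -/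
noncomputable def PSpan.cardMatrix {S T : ZObj.{u}} (M : PSpan S T) (b : Basis S) (b' : Basis T) :
    Matrix (Pi0 S.Locus) (Pi0 T.Locus) ℚ :=
  fun c d => (M.fibre (b.pt c).obj (b'.pt d).obj).card / (autCard (b'.pt d).obj : ℚ)

/-! ## Exterior powers -/

/-- Objects of the weak quotient `C^k / Σ_k`: tuples of objects of `C`. -/
structure Tuple (k : ℕ) (C : Type u) : Type u where
  pt : Fin k → C

namespace Tuple

variable {k : ℕ} {C : Type u} [SmallGroupoid C]

/-- Arrows of the weak quotient `C^k / Σ_k`: a permutation together with arrows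
`y_j ⟶ x_{σ j}`. -/
structure Hom (y x : Tuple k C) : Type u where
  perm : Equiv.Perm (Fin k)
  arr : ∀ j, y.pt j ⟶ x.pt (perm j)

theorem Hom.ext' {y x : Tuple k C} {f g : Hom y x} (h : ∀ j, f.perm j = g.perm j)
    (h' : ∀ j, f.arr j ≫ eqToHom (congrArg x.pt (h j)) = g.arr j) : f = g := by
  obtain ⟨σ, a⟩ := f
  obtain ⟨τ, b⟩ := g
  obtain rfl : σ = τ := Equiv.ext h
  congr
  funext j
  simpa using h' j

instance : SmallCategory (Tuple k C) where
  Hom y x := Hom y x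
  id x := ⟨1, fun j => 𝟙 (x.pt j)⟩
  comp f g := ⟨g.perm * f.perm, fun j => f.arr j ≫ g.arr (f.perm j)⟩
  id_comp f := Hom.ext' (fun _ => rfl) (fun j => by simp)
  comp_id f := Hom.ext' (fun _ => rfl) (fun j => by simp)
  assoc f g h := Hom.ext' (fun _ => rfl) (fun j => by simp)

theorem arr_eqToHom {y x : Tuple k C} (f : Hom y x) {j j' : Fin k} (h : j = j') :
    f.arr j ≫ eqToHom (by rw [h]) = eqToHom (by rw [h]) ≫ f.arr j' := by
  subst h; simp

instance : SmallGroupoid (Tuple k C) where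
  inv {y x} f := ⟨f.perm⁻¹, fun j =>
    eqToHom (by simp) ≫ Groupoid.inv (f.arr (f.perm⁻¹ j))⟩
  inv_comp {y x} f := Hom.ext' (fun j => f.perm.apply_symm_apply j) (fun j => by
    change ((_ ≫ Groupoid.inv (f.arr (f.perm⁻¹ j))) ≫ f.arr (f.perm⁻¹ j)) ≫ _ = 𝟙 _
    rw [Category.assoc (eqToHom _), Groupoid.inv_comp, Category.comp_id]
    exact (eqToHom_trans _ _).trans (eqToHom_refl _ _))
  comp_inv {y x} f := Hom.ext' (fun j => f.perm.symm_apply_apply j) (fun j => by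
    change (f.arr j ≫ (eqToHom _ ≫ Groupoid.inv (f.arr (f.perm⁻¹ (f.perm j))))) ≫ eqToHom _ = 𝟙 _
    have h : f.perm⁻¹ (f.perm j) = j := f.perm.symm_apply_apply j
    have key := arr_eqToHom f h.symm
    rw [← Category.assoc (f.arr j), key]
    rw [Category.assoc (eqToHom _), Groupoid.comp_inv, Category.comp_id]
    exact (eqToHom_trans _ _).trans (eqToHom_refl _ _))

/-- The quotient `C^k / Σ_k` of a finite groupoid is finite. -/
instance [FiniteGroupoid C] : FiniteGroupoid (Tuple k C) where
  finite_pi0 := by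
    let F : (Fin k → Pi0 C) → Pi0 (Tuple k C) := fun c => comp ⟨fun j => (c j).out⟩
    refine Finite.of_surjective F fun a => ?_
    induction a using Quotient.inductionOn with
    | h x =>
      have e (j : Fin k) : Nonempty ((comp (x.pt j)).out ≅ x.pt j) :=
        Quotient.mk_out (s := isIsomorphicSetoid _) (x.pt j)
      exact ⟨fun j => comp (x.pt j), Quotient.sound
        ⟨(Groupoid.isoEquivHom _ _).symm ⟨1, fun j => (e j).some.hom⟩⟩⟩
  finite_hom y x := by
    refine Finite.of_injective (β := Σ σ : Equiv.Perm (Fin k), ∀ j, y.pt j ⟶ x.pt (σ j))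
      (fun f : y ⟶ x => ⟨Hom.perm f, Hom.arr f⟩) ?_
    rintro ⟨σ, a⟩ ⟨τ, b⟩ h
    cases h
    rfl

end Tuple

/-- The `k`th exterior power `Λᵏ X`: the weak quotient `X^k / Σ_k`, an arrow `(σ, γ)` having
parity `sign σ * ∏ j, par (γ j)`. -/
def ZObj.ext (k : ℕ) (X : ZObj.{u}) : ZObj.{u} where
  carrier := Tuple k X
  str := mkStr (fun f => Equiv.Perm.sign (Tuple.Hom.perm f) * ∏ j, X.par (Tuple.Hom.arr f j))
    (fun x => by
      change Equiv.Perm.sign 1 * ∏ j, X.par (𝟙 (x.pt j)) = 1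
      simp)
    (fun f g => by
      change Equiv.Perm.sign (Tuple.Hom.perm g * Tuple.Hom.perm f) *
        ∏ j, X.par (Tuple.Hom.arr f j ≫ Tuple.Hom.arr g (Tuple.Hom.perm f j)) = _
      simp only [ZObj.par_comp, Finset.prod_mul_distrib, map_mul]
      rw [Equiv.prod_comp (Tuple.Hom.perm f) (fun j => X.par (Tuple.Hom.arr g j)),
        mul_comm (Equiv.Perm.sign (Tuple.Hom.perm g)), mul_mul_mul_comm])

/-- The `k`th exterior power of a morphism of `𝒵`. -/
def ZHom.ext (k : ℕ) {X Y : ZObj.{u}} (F : ZHom X Y) : ZHom (X.ext k) (Y.ext k) :=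
  mkHom (X := X.ext k) (Y := Y.ext k)
    { obj := fun x => ⟨fun j => F.functor.obj (x.pt j)⟩
      map := fun f => ⟨Tuple.Hom.perm f, fun j => F.functor.map (Tuple.Hom.arr f j)⟩
      map_id := fun x => Tuple.Hom.ext' (fun _ => rfl)
        (fun j => (Category.comp_id _).trans (F.functor.map_id (x.pt j)))
      map_comp := fun f g => Tuple.Hom.ext' (fun _ => rfl)
        (fun j => (Category.comp_id _).trans
          (F.functor.map_comp (Tuple.Hom.arr f j) (Tuple.Hom.arr g (Tuple.Hom.perm f j)))) }
    (fun x => ∏ j, F.sgn (x.pt j))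
    (by
      intro x y f
      change (Equiv.Perm.sign (Tuple.Hom.perm f) * ∏ j, X.par (Tuple.Hom.arr f j)) *
          ∏ j, F.sgn (y.pt j) =
        (∏ j, F.sgn (x.pt j)) * (Equiv.Perm.sign (Tuple.Hom.perm f) *
          ∏ j, Y.par (F.functor.map (Tuple.Hom.arr f j)))
      rw [← Equiv.prod_comp (Tuple.Hom.perm f) (fun j => F.sgn (y.pt j)), mul_assoc,
        ← Finset.prod_mul_distrib, mul_left_comm, ← Finset.prod_mul_distrib]
      simp only [ZHom.naturality])

/-- The `k`th exterior power of a span, given componentwise. -/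
def PSpan.ext (k : ℕ) {S T : ZObj.{u}} (M : PSpan S T) : PSpan (S.ext k) (T.ext k) where
  apex := M.apex.ext k
  left := M.left.ext k
  right := M.right.ext k

/-- The determinant of an endo-span: its `n`th exterior power, where `n` is the number of
orientable components of `X`. -/
noncomputable def PSpan.det {X : ZObj.{u}} (A : PSpan X X) :
    PSpan (X.ext X.dim) (X.ext X.dim) :=
  A.ext X.dim

/-- The point `(x_1, …, x_k)` of the exterior power `Λᵏ X`. -/
def wedge {k : ℕ} {X : ZObj.{u}} (x : Fin k → X) : X.ext k := Tuple.mk x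

end ObjLin

namespace ObjLin

/-! ## Sums over the components of a finite groupoid -/

/-! The determinant identity is the Leibniz expansion, read off from components of a groupoid. A
point of the two-sided fibre of `Λᵏ A` over tuples `x`, `y` can be renumbered so that its source
permutation is trivial. What remains is a permutation `τ` and a point of each fibre of `A` over `x
j`, `y (τ j)`. Arrows between such normal forms preserve `τ` and act entrywise, so automorphism
counts multiply and the sign is `sign τ` times the product of signs. Summing gives
`PSpan.fibre_ext_card`.

Orientable points of `Λᵏ X` are the tuples of pairwise non-isomorphic orientable points: an
isomorphism between two entries would give an odd transposition. The automorphisms of such a tuple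
are again entrywise, which supplies the denominators (`Independent.det_formula`). For `k = n` such a
tuple meets every orientable component once, so any two are isomorphic. A change of base points
conjugates the matrix by a diagonal matrix of signs (`Independent.det_cardMatrix`). -/

theorem comp_eq_iff {C : Type u} [SmallGroupoid C] {x y : C} :
    comp x = comp y ↔ Nonempty (x ⟶ y) :=
  Quotient.eq.trans ⟨fun ⟨e⟩ => ⟨e.hom⟩, fun ⟨f⟩ => ⟨(Groupoid.isoEquivHom _ _).symm f⟩⟩

theorem comp_out {C : Type u} [SmallGroupoid C] (c : Pi0 C) : comp c.out = c :=
  Quotient.out_eq c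

theorem exists_hom_out {C : Type u} [SmallGroupoid C] (x : C) : Nonempty (x ⟶ (comp x).out) :=
  comp_eq_iff.1 (comp_out _).symm

theorem autCard_eq_card_hom {C : Type u} [SmallGroupoid C] (x : C) :
    autCard x = Nat.card (x ⟶ x) :=
  Nat.card_congr (Groupoid.isoEquivHom x x)

theorem autCard_congr {C : Type u} [SmallGroupoid C] {x y : C} (f : x ⟶ y) :
    autCard x = autCard y :=
  Nat.card_congr (Aut.autMulEquivOfIso ((Groupoid.isoEquivHom _ _).symm f)).toEquiv

theorem autCard_obj {C : Type u} [SmallGroupoid C] {P : ObjectProperty C}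
    (x : P.FullSubcategory) : autCard x = autCard x.obj := by
  rw [autCard_eq_card_hom, autCard_eq_card_hom]
  exact Nat.card_congr ⟨fun f => f.hom, fun f => ObjectProperty.homMk f, fun _ => rfl, fun _ => rfl⟩

/-- A sum over components may be computed with any system of representatives. -/
theorem sum_pi0_eq {C : Type u} [SmallGroupoid C] [FiniteGroupoid C] (f : C → ℚ)
    (hf : ∀ {x y : C}, (x ⟶ y) → f x = f y) {I : Type*} [Fintype I] (q : I → C)
    (hq : Function.Bijective fun i => comp (q i)) :
    ∑ c : Pi0 C, f c.out = ∑ i, f (q i) := by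
  rw [← (Equiv.ofBijective _ hq).sum_comp]
  exact Finset.sum_congr rfl fun i _ => (hf (exists_hom_out (q i)).some).symm

/-- Writes the cardinality over the components of all of `C`, so that the positive and negative
parts of a scalar can be subtracted termwise. -/
theorem groupoidCard_fullSubcategory {C : Type u} [SmallGroupoid C] [FiniteGroupoid C]
    (P : ObjectProperty C) [DecidablePred P] (hP : ∀ {x y : C}, (x ⟶ y) → P x → P y) :
    groupoidCard P.FullSubcategory =
      ∑ c : Pi0 C, if P c.out then 1 / (autCard c.out : ℚ) else 0 := by
  rw [groupoidCard, ← Finset.sum_filter, Finset.sum_subtype (p := fun c : Pi0 C => P c.out) _ (by simp),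
    sum_pi0_eq (fun x : P.FullSubcategory => 1 / (autCard x : ℚ))
      (fun f => by rw [autCard_congr f]) (fun c : {c : Pi0 C // P c.out} => ⟨c.1.out, c.2⟩)]
  · exact Finset.sum_congr rfl fun c _ => by rw [autCard_obj]
  constructor
  · intro c d h
    obtain ⟨f⟩ := comp_eq_iff.1 h
    have h' : comp c.1.out = comp d.1.out := comp_eq_iff.2 ⟨f.hom⟩
    rw [comp_out, comp_out] at h'
    exact Subtype.ext h'
  · intro a
    induction a using Quotient.inductionOn with
    | h x =>
      obtain ⟨f⟩ := exists_hom_out x.obj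
      exact ⟨⟨comp x.obj, hP f x.property⟩, comp_eq_iff.2 ⟨ObjectProperty.homMk (Groupoid.inv f)⟩⟩

theorem ZHom.sgn_congr {Y : ZObj.{u}} (F : ZHom Y unitObj) {x y : Y} (f : x ⟶ y) :
    Y.par f * F.sgn y = F.sgn x :=
  (F.naturality f).trans (mul_one _)

/-- Both 2-cells change by the same factor `par f`, which cancels in the ratio. -/
theorem Scalar.ratio_congr (S : Scalar.{u}) {x y : S.apex} (f : x ⟶ y) :
    S.ratio x = S.ratio y := by
  rw [PSpan.ratio, PSpan.ratio, ← S.left.sgn_congr f, ← S.right.sgn_congr f, mul_inv,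
    mul_mul_mul_comm, inv_mul_cancel, one_mul]

/-- The contribution of a point to the cardinality of a scalar. -/
noncomputable def Scalar.weight (S : Scalar.{u}) (x : S.apex) : ℚ :=
  ((S.ratio x : ℤ) : ℚ) / (autCard x : ℚ)

theorem Scalar.weight_congr (S : Scalar.{u}) {x y : S.apex} (f : x ⟶ y) :
    S.weight x = S.weight y := by
  rw [weight, weight, S.ratio_congr f, autCard_congr f]

theorem Scalar.card_eq_sum (S : Scalar.{u}) :
    S.card = ∑ c : Pi0 S.apex, S.weight c.out := by
  classical
  rw [Scalar.card, groupoidCard_fullSubcategory _ fun f h => (S.ratio_congr f).symm.trans h,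
    groupoidCard_fullSubcategory _ fun f h => (S.ratio_congr f).symm.trans h,
    ← Finset.sum_sub_distrib]
  refine Finset.sum_congr rfl fun c _ => ?_
  rw [weight]
  rcases Int.units_eq_one_or (S.ratio c.out) with h | h <;> simp [h, neg_div]

theorem Scalar.card_eq_sum_of_bijective (S : Scalar.{u}) {I : Type*} [Fintype I] (q : I → S.apex)
    (hq : Function.Bijective fun i => comp (q i)) : S.card = ∑ i, S.weight (q i) :=
  S.card_eq_sum.trans (sum_pi0_eq S.weight S.weight_congr q hq)

/-! ## Change of base points -/

theorem ZObj.par_inv (X : ZObj.{u}) {x y : X} (f : x ⟶ y) : X.par (Groupoid.inv f) = X.par f := by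
  have h : X.par f * X.par (Groupoid.inv f) = 1 := by
    rw [← X.par_comp, Groupoid.comp_inv, X.par_id]
  rw [eq_inv_of_mul_eq_one_right h, Int.units_inv_eq_self]

section
variable {S T : ZObj.{u}} (M : PSpan S T) {i i' : S} {j j' : T}

/-- Transport of points of two-sided fibres along arrows of the feet. -/
def PSpan.Fib.move (e : i' ⟶ i) (f : j ⟶ j') (p : M.Fib i j) : M.Fib i' j' :=
  ⟨p.pt, e ≫ p.src, p.tgt ≫ f⟩

/-- Transport of arrows of two-sided fibres along arrows of the feet. -/
def PSpan.Fib.moveHom (e : i' ⟶ i) (f : j ⟶ j') (p q : M.Fib i j) :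
    (p ⟶ q) ≃ (p.move M e f ⟶ q.move M e f) where
  toFun g := ⟨g.hom, by simp [move], by simp [move, ← Category.assoc]⟩
  invFun g := ⟨g.hom, (cancel_epi e).1 (by simpa [move] using g.src_comp),
    (cancel_mono f).1 (by simpa [move, ← Category.assoc] using g.comp_tgt)⟩
  left_inv _ := rfl
  right_inv _ := rfl

/-- Transport along `e` and `f` is an equivalence of fibres that multiplies every sign by `par e *
par f`. -/
theorem PSpan.fibre_card_congr (e : i' ⟶ i) (f : j ⟶ j') :
    (M.fibre i' j').card = ((S.par e * T.par f : ℤˣ) : ℤ) * (M.fibre i j).card := by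
  rw [Scalar.card_eq_sum (M.fibre i j), Finset.mul_sum,
    Scalar.card_eq_sum_of_bijective (M.fibre i' j')
      (I := Pi0 (M.Fib i j)) (fun c => PSpan.Fib.move M e f c.out)]
  · refine Finset.sum_congr rfl fun c _ => ?_
    have h : autCard (PSpan.Fib.move M e f c.out) = autCard c.out := by
      rw [autCard_eq_card_hom, autCard_eq_card_hom]
      exact (Nat.card_congr (PSpan.Fib.moveHom M e f _ _)).symm
    change (((M.fibre i' j').ratio (PSpan.Fib.move M e f c.out) : ℤ) : ℚ) /
      (autCard (PSpan.Fib.move M e f c.out) : ℚ) =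
        _ * ((((M.fibre i j).ratio c.out : ℤ) : ℚ) / (autCard c.out : ℚ))
    rw [h, M.fibre_ratio, M.fibre_ratio, ← mul_div_assoc, PSpan.Fib.move]
    simp only [ZObj.par_comp]
    push_cast
    ring
  · constructor
    · intro c d h
      obtain ⟨g⟩ := comp_eq_iff.1 h
      have h' := comp_eq_iff.2 ⟨(PSpan.Fib.moveHom M e f _ _).symm g⟩
      rwa [comp_out, comp_out] at h'
    · intro a
      induction a using Quotient.inductionOn with
      | h p =>
        -- Transporting back along the inverses and forth again returns `p` on the nose.
        let p' : M.Fib i j := p.move M (Groupoid.inv e) (Groupoid.inv f)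
        have hp : p'.move M e f = p := by
          cases p
          simp [p', PSpan.Fib.move]
        obtain ⟨g⟩ := exists_hom_out p'
        refine ⟨comp p', (comp_eq_iff.2 ⟨PSpan.Fib.moveHom M e f _ _ g⟩).symm.trans ?_⟩
        exact congrArg comp hp

end

/-! ## Two-sided fibres of exterior powers -/

/-- Extracts entrywise equations from an equality of arrows. When the two permutations agree
definitionally, the `eqToHom` is an identity and `Category.comp_id` removes it. -/
theorem Tuple.Hom.arr_congr {k : ℕ} {C : Type u} [SmallGroupoid C] {y x : Tuple k C}
    {f g : Tuple.Hom y x} (h : f = g) (j : Fin k) :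
    f.arr j ≫ eqToHom (congrArg (fun a : Tuple.Hom y x => x.pt (a.perm j)) h) = g.arr j := by
  subst h
  simp

section
variable {k : ℕ} {S T : ZObj.{u}} (M : PSpan S T) {x : Fin k → S} {y : Fin k → T}

/-- The point of a two-sided fibre of an exterior power given by a permutation and a tuple of
points of two-sided fibres. -/
def PSpan.Fib.wedge (τ : Equiv.Perm (Fin k)) (p : ∀ j, M.Fib (x j) (y (τ j))) :
    (M.ext k).Fib (ObjLin.wedge x) (ObjLin.wedge y) where
  pt := ⟨fun j => (p j).pt⟩
  src := ⟨1, fun j => (p j).src⟩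
  tgt := ⟨τ, fun j => (p j).tgt⟩

/-- The arrow of a two-sided fibre of an exterior power given by a tuple of arrows. -/
def PSpan.Fib.wedgeHom {τ : Equiv.Perm (Fin k)} {p q : ∀ j, M.Fib (x j) (y (τ j))}
    (φ : ∀ j, p j ⟶ q j) : wedge M τ p ⟶ wedge M τ q where
  hom := ⟨1, fun j => (φ j).hom⟩
  src_comp := Tuple.Hom.ext' (fun _ => rfl)
    (fun j => (Category.comp_id _).trans (φ j).src_comp)
  comp_tgt := Tuple.Hom.ext' (fun _ => rfl)
    (fun j => (Category.comp_id _).trans (φ j).comp_tgt)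

/-- Both source arrows have trivial permutation, and compatibility with them leaves no freedom. -/
theorem PSpan.Fib.perm_eq_one {τ τ' : Equiv.Perm (Fin k)} {p : ∀ j, M.Fib (x j) (y (τ j))}
    {q : ∀ j, M.Fib (x j) (y (τ' j))} (g : wedge M τ p ⟶ wedge M τ' q) :
    Tuple.Hom.perm (PSpan.Fib.Hom.hom g) = 1 :=
  (mul_one _).symm.trans (congrArg Tuple.Hom.perm (PSpan.Fib.Hom.src_comp g))

/-- Hence `τ` is an isomorphism invariant of the normal form. -/
theorem PSpan.Fib.perm_eq {τ τ' : Equiv.Perm (Fin k)} {p : ∀ j, M.Fib (x j) (y (τ j))}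
    {q : ∀ j, M.Fib (x j) (y (τ' j))} (g : wedge M τ p ⟶ wedge M τ' q) : τ' = τ := by
  have h : τ' * Tuple.Hom.perm (PSpan.Fib.Hom.hom g) = τ :=
    congrArg Tuple.Hom.perm (PSpan.Fib.Hom.comp_tgt g)
  rwa [perm_eq_one, mul_one] at h

theorem PSpan.Fib.wedgeHom_bijective {τ : Equiv.Perm (Fin k)}
    {p q : ∀ j, M.Fib (x j) (y (τ j))} :
    Function.Bijective (wedgeHom M : (∀ j, p j ⟶ q j) → (wedge M τ p ⟶ wedge M τ q)) := by
  constructor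
  · intro φ ψ h
    funext j
    refine PSpan.Fib.Hom.ext ?_
    have h' := Tuple.Hom.arr_congr (congrArg PSpan.Fib.Hom.hom h) j
    exact (Category.comp_id _).symm.trans h'
  · intro g
    have h1 := perm_eq_one M g
    obtain ⟨⟨π, a⟩, hs, ht⟩ := g
    change π = 1 at h1
    subst h1
    exact ⟨fun j => ⟨a j, (Category.comp_id _).symm.trans (Tuple.Hom.arr_congr hs j),
      (Category.comp_id _).symm.trans (Tuple.Hom.arr_congr ht j)⟩, rfl⟩

theorem PSpan.Fib.exists_hom_wedge (p : (M.ext k).Fib (ObjLin.wedge x) (ObjLin.wedge y)) :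
    ∃ (τ : Equiv.Perm (Fin k)) (q : ∀ j, M.Fib (x j) (y (τ j))),
      Nonempty (wedge M τ q ⟶ p) := by
  obtain ⟨⟨m⟩, ⟨σ, a⟩, ⟨τ, b⟩⟩ := p
  -- Renumbering the apex tuple by `σ` trivialises the source permutation and moves `σ` to the
  -- target side.
  refine ⟨τ * σ, fun j => ⟨m (σ j), a j, b (σ j)⟩, ⟨⟨⟨σ, fun j => 𝟙 (m (σ j))⟩, ?_, ?_⟩⟩⟩
  · exact Tuple.Hom.ext' (fun _ => rfl) fun j => (Category.comp_id _).trans <|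
      (congrArg (a j ≫ ·) (M.left.functor.map_id (m (σ j)))).trans (Category.comp_id (a j))
  · exact Tuple.Hom.ext' (fun _ => rfl) fun j => (Category.comp_id _).trans <|
      (congrArg (· ≫ b (σ j)) (M.right.functor.map_id (m (σ j)))).trans
        (Category.id_comp (b (σ j)))

theorem PSpan.Fib.autCard_wedge (τ : Equiv.Perm (Fin k)) (p : ∀ j, M.Fib (x j) (y (τ j))) :
    autCard (wedge M τ p) = ∏ j, autCard (p j) := by
  simp only [autCard_eq_card_hom]
  rw [← Nat.card_congr (Equiv.ofBijective _ (wedgeHom_bijective M)), Nat.card_pi]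

theorem PSpan.ext_ratio (m : (M.ext k).apex) :
    (M.ext k).ratio m = ∏ j, M.ratio (Tuple.pt m j) := by
  change (∏ j, M.left.sgn (Tuple.pt m j))⁻¹ * ∏ j, M.right.sgn (Tuple.pt m j) = _
  rw [← Finset.prod_inv_distrib, ← Finset.prod_mul_distrib]
  rfl

theorem PSpan.Fib.ratio_wedge (τ : Equiv.Perm (Fin k)) (p : ∀ j, M.Fib (x j) (y (τ j))) :
    ((M.ext k).fibre (ObjLin.wedge x) (ObjLin.wedge y)).ratio (wedge M τ p) =
      Equiv.Perm.sign τ * ∏ j, (M.fibre (x j) (y (τ j))).ratio (p j) := by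
  rw [PSpan.fibre_ratio, PSpan.ext_ratio]
  simp only [PSpan.fibre_ratio, Finset.prod_mul_distrib]
  change (Equiv.Perm.sign 1 * ∏ j, S.par (p j).src) * (∏ j, M.ratio (p j).pt) *
    (Equiv.Perm.sign τ * ∏ j, T.par (p j).tgt) = _
  rw [map_one, one_mul, mul_left_comm]

variable (x y) in
/-- The cardinality of a two-sided fibre of an exterior power. -/
theorem PSpan.fibre_ext_card :
    ((M.ext k).fibre (wedge x) (wedge y)).card =
      ∑ τ : Equiv.Perm (Fin k), ((Equiv.Perm.sign τ : ℤ) : ℚ) *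
        ∏ j, (M.fibre (x j) (y (τ j))).card := by
  classical
  rw [Scalar.card_eq_sum_of_bijective ((M.ext k).fibre (wedge x) (wedge y))
    (I := Σ τ : Equiv.Perm (Fin k), ∀ j, Pi0 (M.Fib (x j) (y (τ j))))
    (fun c => PSpan.Fib.wedge M c.1 fun j => (c.2 j).out)]
  · rw [Fintype.sum_sigma]
    refine Finset.sum_congr rfl fun τ _ => ?_
    simp only [Scalar.card_eq_sum]
    -- The product over `j` of sums over components becomes a sum over tuples of components.
    rw [Finset.prod_univ_sum, Fintype.piFinset_univ, Finset.mul_sum]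
    refine Finset.sum_congr rfl fun c _ => ?_
    have h := PSpan.Fib.autCard_wedge M τ fun j => (c j).out
    have h' := PSpan.Fib.ratio_wedge M τ fun j => (c j).out
    refine (congrArg₂ (fun (a : ℤˣ) (b : ℕ) => ((a : ℤ) : ℚ) / (b : ℚ)) h' h).trans ?_
    simp only [Scalar.weight]
    push_cast
    rw [Finset.prod_div_distrib, mul_div_assoc]
    rfl
  · constructor
    · rintro ⟨τ, c⟩ ⟨τ', d⟩ h
      obtain ⟨g⟩ := comp_eq_iff.1 h
      obtain rfl := PSpan.Fib.perm_eq M g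
      obtain ⟨φ, -⟩ := (PSpan.Fib.wedgeHom_bijective M).2 g
      refine Sigma.ext rfl (heq_of_eq (funext fun j => ?_))
      have h' := comp_eq_iff.2 ⟨φ j⟩
      rwa [comp_out, comp_out] at h'
    · intro a
      induction a using Quotient.inductionOn with
      | h p =>
        obtain ⟨τ, q, ⟨g⟩⟩ := PSpan.Fib.exists_hom_wedge M p
        exact ⟨⟨τ, fun j => comp (q j)⟩, comp_eq_iff.2
          ⟨PSpan.Fib.wedgeHom M (fun j => Groupoid.inv (exists_hom_out (q j)).some) ≫ g⟩⟩

end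

/-! ## Orientable points of exterior powers -/

/-- A tuple of points is independent if its entries are orientable and pairwise not isomorphic. -/
structure Independent {k : ℕ} {X : ZObj.{u}} (x : Fin k → X) : Prop where
  orientable : ∀ j, X.Orientable (x j)
  eq_of_hom : ∀ {i j}, (x i ⟶ x j) → i = j

section
variable {k : ℕ} {X : ZObj.{u}} {x : Fin k → X}

/-- Replaces `eqToHom` by an arrow of known parity when the target is only propositionally the right
one. -/
theorem ZObj.exists_hom_par_one {y z : X} (h : y = z) : ∃ f : y ⟶ z, X.par f = 1 := by
  subst h
  exact ⟨𝟙 y, X.par_id y⟩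

theorem Independent.perm_eq_one (hx : Independent x) (f : Tuple.Hom (wedge x) (wedge x)) :
    f.perm = 1 :=
  Equiv.ext fun j => (hx.eq_of_hom (f.arr j)).symm

theorem Independent.orientable_wedge (hx : Independent x) : (X.ext k).Orientable (wedge x) := by
  intro f
  have h1 := hx.perm_eq_one f
  obtain ⟨σ, a⟩ := f
  change σ = 1 at h1
  subst h1
  change Equiv.Perm.sign 1 * ∏ j, X.par (a j) = 1
  rw [map_one, one_mul]
  exact Finset.prod_eq_one fun j _ => hx.orientable j (a j)

theorem Independent.autCard_wedge (hx : Independent x) :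
    autCard (wedge x) = ∏ j, autCard (x j) := by
  simp only [autCard_eq_card_hom]
  rw [← Nat.card_pi]
  refine (Nat.card_congr (Equiv.ofBijective
    (fun a => (⟨1, a⟩ : Tuple.Hom (wedge x) (wedge x))) ⟨?_, ?_⟩)).symm
  · intro a b h
    funext j
    exact (Category.comp_id _).symm.trans (Tuple.Hom.arr_congr h j)
  · intro f
    have h1 := hx.perm_eq_one f
    obtain ⟨σ, a⟩ := f
    change σ = 1 at h1
    subst h1
    exact ⟨a, rfl⟩

theorem Independent.of_orientable_wedge (hx : (X.ext k).Orientable (wedge x)) :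
    Independent x where
  orientable j g := by
    -- The automorphism acting by `g` in entry `j` and trivially elsewhere has parity `par g`.
    have h := hx ⟨1, Function.update (fun i => 𝟙 (x i)) j g⟩
    change Equiv.Perm.sign 1 *
      ∏ i, X.par (Function.update (fun i => 𝟙 (x i)) j g i : x i ⟶ x i) = 1 at h
    rw [map_one, one_mul, Finset.prod_eq_single j] at h
    · simpa using h
    · intro i _ hi
      rw [Function.update_of_ne hi, X.par_id]
    · simp
  eq_of_hom {i j} e := by
    by_contra hij
    -- The arrows over the transposition are `e` at `i`, its inverse at `j` and identities
    -- elsewhere. Their parities multiply to `par e ^ 2 = 1`, so the automorphism has the parity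
    -- `-1` of the transposition.
    have key (l : Fin k) : ∃ f : x l ⟶ x (Equiv.swap i j l),
        X.par f = (if l = i then X.par e else 1) * (if l = j then X.par e else 1) := by
      by_cases hi : l = i
      · subst hi
        obtain ⟨f, hf⟩ := X.exists_hom_par_one (congrArg x (Equiv.swap_apply_left l j).symm)
        exact ⟨e ≫ f, by simp [hf, hij]⟩
      by_cases hj : l = j
      · subst hj
        obtain ⟨f, hf⟩ := X.exists_hom_par_one (congrArg x (Equiv.swap_apply_right i l).symm)
        exact ⟨Groupoid.inv e ≫ f, by rw [X.par_comp, X.par_inv, hf]; simp [hi]⟩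
      obtain ⟨f, hf⟩ := X.exists_hom_par_one (congrArg x (Equiv.swap_apply_of_ne_of_ne hi hj).symm)
      exact ⟨f, by simp [hf, hi, hj]⟩
    choose a ha using key
    have h := hx ⟨Equiv.swap i j, a⟩
    change Equiv.Perm.sign (Equiv.swap i j) * ∏ l, X.par (a l) = 1 at h
    simp_rw [ha] at h
    rw [Finset.prod_mul_distrib, Equiv.Perm.sign_swap hij] at h
    simp at h

/-- The formula for the determinant at an arbitrary independent tuple. -/
theorem Independent.det_formula (hx : Independent x) (A : PSpan X X) :
    ((A.ext k).fibre (wedge x) (wedge x)).card / (autCard (wedge x) : ℚ) =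
      (Matrix.of fun i j => (A.fibre (x i) (x j)).card / (autCard (x j) : ℚ)).det := by
  -- The transpose is needed because `Matrix.det_apply'` permutes row indices, while `τ` acts here
  -- on columns.
  rw [A.fibre_ext_card, hx.autCard_wedge, ← Matrix.det_transpose, Matrix.det_apply',
    Finset.sum_div]
  refine Finset.sum_congr rfl fun τ _ => ?_
  simp only [Matrix.transpose_apply, Matrix.of_apply, Finset.prod_div_distrib]
  -- The denominators are permuted by `τ`, so their product does not depend on it.
  rw [mul_div_assoc, Equiv.prod_comp τ fun j => (autCard (x j) : ℚ), Nat.cast_prod]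

/-- The orientable component of an entry of an independent tuple. -/
def Independent.compLocus (hx : Independent x) (j : Fin k) : Pi0 X.Locus :=
  comp ⟨x j, hx.orientable j⟩

theorem Independent.compLocus_injective (hx : Independent x) :
    Function.Injective hx.compLocus := fun _ _ h =>
  hx.eq_of_hom (comp_eq_iff.1 h).some.hom

end

/-! ### Independent tuples of length equal to the number of orientable components -/

section
variable {X : ZObj.{u}} {x y : Fin X.dim → X}

theorem Independent.compLocus_bijective (hx : Independent x) :
    Function.Bijective hx.compLocus :=
  (Fintype.bijective_iff_injective_and_card _).2
    ⟨hx.compLocus_injective, by rw [Fintype.card_fin, ZObj.dim, Nat.card_eq_fintype_card]⟩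

/-- Both tuples enumerate the orientable components, and the permutation matches the two
enumerations. -/
theorem Independent.nonempty_hom (hx : Independent x) (hy : Independent y) :
    Nonempty (wedge x ⟶ wedge y) := by
  let σ := (Equiv.ofBijective _ hx.compLocus_bijective).trans
    (Equiv.ofBijective _ hy.compLocus_bijective).symm
  have h (j) : hy.compLocus (σ j) = hx.compLocus j :=
    (Equiv.ofBijective _ hy.compLocus_bijective).apply_symm_apply _
  exact ⟨⟨σ, fun j => (comp_eq_iff.1 (h j).symm).some.hom⟩⟩

variable (X) in
theorem exists_independent : ∃ x : Fin X.dim → X, Independent x := by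
  let e : Fin X.dim ≃ Pi0 X.Locus := (Finite.equivFin _).symm
  refine ⟨fun j => (e j).out.obj, fun j => (e j).out.property, fun {i j} f => ?_⟩
  have h : comp (e i).out = comp (e j).out := comp_eq_iff.2 ⟨ObjectProperty.homMk f⟩
  rw [comp_out, comp_out] at h
  exact e.injective h

variable (X) in
theorem card_pi0_locus_ext : Nat.card (Pi0 (X.ext X.dim).Locus) = 1 := by
  rw [Nat.card_eq_one_iff_unique]
  refine ⟨⟨fun a b => ?_⟩, ?_⟩
  · induction a using Quotient.inductionOn with
    | h p =>
      induction b using Quotient.inductionOn with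
      | h q =>
        have hp : Independent (Tuple.pt p.obj) := .of_orientable_wedge p.property
        have hq : Independent (Tuple.pt q.obj) := .of_orientable_wedge q.property
        exact comp_eq_iff.2 ⟨ObjectProperty.homMk (hp.nonempty_hom hq).some⟩
  · obtain ⟨x, hx⟩ := exists_independent X
    exact ⟨comp ⟨wedge x, hx.orientable_wedge⟩⟩

/-- With `s j` the parity of a chosen arrow from `x j` to the base point of its component, the
entries differ by `s i * s j`. Each sign thus enters the determinant once from a row and once from a
column, and `s j * s j = 1`. -/
theorem Independent.det_cardMatrix (hx : Independent x) (A : PSpan X X) (b : Basis X) :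
    (Matrix.of fun i j => (A.fibre (x i) (x j)).card / (autCard (x j) : ℚ)).det =
      (A.cardMatrix b b).det := by
  let e := Equiv.ofBijective _ hx.compLocus_bijective
  have hf (j) : Nonempty (x j ⟶ (b.pt (e j)).obj) :=
    ⟨(comp_eq_iff.1 (b.comp_pt (e j)).symm).some.hom⟩
  let f (j) := (hf j).some
  let s (j) : ℚ := ((X.par (f j) : ℤ) : ℚ)
  have hs (j) : s j * s j = 1 := by
    rw [← Int.cast_mul, ← Units.val_mul, Int.units_mul_self]
    simp
  have hM : (Matrix.of fun i j => (A.fibre (x i) (x j)).card / (autCard (x j) : ℚ)) =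
      Matrix.of fun i j => s i * (Matrix.of fun i j => s j *
        (A.cardMatrix b b).submatrix e e i j) i j := by
    ext i j
    simp only [Matrix.of_apply, Matrix.submatrix_apply, PSpan.cardMatrix, s]
    rw [A.fibre_card_congr (f i) (Groupoid.inv (f j)), autCard_congr (f j), X.par_inv]
    push_cast
    ring
  rw [hM, Matrix.det_mul_column, Matrix.det_mul_row, Matrix.det_submatrix_equiv_self,
    ← mul_assoc, ← Finset.prod_mul_distrib, Finset.prod_eq_one fun j _ => hs j, one_mul]

end

end ObjLin

theorem mainTheorem2 (X : ObjLin.ZObj.{u}) (A : ObjLin.PSpan X X) :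
    Nat.card (ObjLin.Pi0 (X.ext X.dim).Locus) = 1 ∧
    (∀ (b : ObjLin.Basis X) (b' : ObjLin.Basis (X.ext X.dim))
        (c c' : ObjLin.Pi0 (X.ext X.dim).Locus),
      A.det.cardMatrix b' b' c c' = (A.cardMatrix b b).det) ∧
    (∀ x : Fin X.dim → X, (∀ i, X.Orientable (x i)) →
      (∀ y : X, X.Orientable y → ∃! i, Nonempty (y ≅ x i)) →
      (X.ext X.dim).Orientable (ObjLin.wedge x) ∧
      ObjLin.autCard (ObjLin.wedge x) = ∏ i, ObjLin.autCard (x i) ∧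
      (A.det.fibre (ObjLin.wedge x) (ObjLin.wedge x)).card / (ObjLin.autCard (ObjLin.wedge x) : ℚ) =
        (Matrix.of fun i j =>
          (A.fibre (x i) (x j)).card / (ObjLin.autCard (x j) : ℚ)).det) := by
  refine ⟨ObjLin.card_pi0_locus_ext X, fun b b' c c' => ?_, fun x hx hx' => ?_⟩
  · have := (Nat.card_eq_one_iff_unique.1 (ObjLin.card_pi0_locus_ext X)).1
    obtain rfl := Subsingleton.elim c c'
    -- The base point of `Λⁿ X` is itself an independent tuple, so the formula applies to it
    -- directly. Its entries need not be the base points `b`.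
    have h : ObjLin.Independent (ObjLin.Tuple.pt (b'.pt c).obj) :=
      .of_orientable_wedge (b'.pt c).property
    exact (h.det_formula A).trans (h.det_cardMatrix A b)
  -- Independence is the uniqueness half of `∃!`, applied to `x i`.
  · have h : ObjLin.Independent x := ⟨hx, fun {i j} f => (hx' (x i) (hx i)).unique
      ⟨Iso.refl _⟩ ⟨(Groupoid.isoEquivHom _ _).symm f⟩⟩
    exact ⟨h.orientable_wedge, h.autCard_wedge, h.det_formula A⟩
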